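/- Let $n\ge 0$ be an integer and let $V_2(\mathbb{C}^n)$ be the Stiefel manifold of pairs $(u_1,u_2)$ of orthonormal vectors in $\mathbb{C}^n$. Put $$W=\{(u_1,u_2)\in V_2(\mathbb{C}^n) : |u_{1k}|=|u_{2k}| \text{ for } k=1,\dots,n\}$$ and, for $i,j\in\{1,\dots,n\}$, $$W_{ij}=\{(u_1,u_2)\in W : u_{1i}\neq 0,\ u_{2j}\neq 0,\ \operatorname{Im}(u_{1i})=\operatorname{Im}(u_{2j})=0\}.$$ Identify $\mathbb{C}^n\times\mathbb{C}^n$ with $\mathbb{R}^{4n}$ through real and imaginary parts of the coordinates. Then $W$ and all the sets $W_{ij}$ are semialgebraic subsets of $\mathbb{R}^{4n}$, and $$\dim W\le 3n-3,\qquad \dim W_{ij}\le 3n-5 .$$ Here the dimension of a semialgebraic set $S\subseteq\mathbb{R}^{m}$ is the Krull dimension of $\mathbb{R}[X_1,\dots,X_m]/I(S)$, where $I(S)$ is the ideal of polynomials vanishing on $S$, and $\dim\emptyset=-\infty$. -/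

import Mathlib

/-- The semialgebraic subsets of `ℝ^σ`: the smallest family of subsets that contains every set
`{x | 0 < p x}` with `p` a real polynomial and is closed under complements and (finite) unions,
hence under all finite Boolean combinations. -/
inductive IsSemialgebraic {σ : Type*} : Set (σ → ℝ) → Prop
  | pos (p : MvPolynomial σ ℝ) : IsSemialgebraic {x | 0 < MvPolynomial.eval x p}
  | compl {S : Set (σ → ℝ)} : IsSemialgebraic S → IsSemialgebraic Sᶜ
  | union {S T : Set (σ → ℝ)} : IsSemialgebraic S → IsSemialgebraic T → IsSemialgebraic (S ∪ T)

/-- The dimension of a (semialgebraic) set `S ⊆ ℝ^σ`: the Krull dimension of the ring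
`ℝ[X] / I(S)`, where `I(S)` is the ideal of all polynomials vanishing on `S`.
The empty set has dimension `⊥`, that is, `-∞`. -/
noncomputable def semialgebraicDim {σ : Type*} (S : Set (σ → ℝ)) : WithBot ℕ∞ :=
  ringKrullDim (MvPolynomial σ ℝ ⧸ MvPolynomial.vanishingIdeal ℝ S)

/-- The Stiefel manifold `V_2(ℂⁿ)` of orthonormal pairs of vectors in `ℂⁿ`. -/
def stiefelTwo (n : ℕ) : Set (EuclideanSpace ℂ (Fin n) × EuclideanSpace ℂ (Fin n)) :=
  {u | Orthonormal ℂ ![u.1, u.2]}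

/-- The identification of `ℂⁿ × ℂⁿ` with `ℝ^{4n}`, by the real and imaginary parts of all the
coordinates of the two vectors. -/
noncomputable def realCoords (n : ℕ) :
    (EuclideanSpace ℂ (Fin n) × EuclideanSpace ℂ (Fin n)) ≃ (Fin 4 × Fin n → ℝ) where
  toFun u := fun q => ![(u.1 q.2).re, (u.1 q.2).im, (u.2 q.2).re, (u.2 q.2).im] q.1
  invFun x := (WithLp.toLp 2 fun i => ⟨x (0, i), x (1, i)⟩,
    WithLp.toLp 2 fun i => ⟨x (2, i), x (3, i)⟩)
  left_inv u := by
    ext i <;> simp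
  right_inv x := by
    funext q
    obtain ⟨k, i⟩ := q
    fin_cases k <;> simp

/-- The set `W` of orthonormal pairs `(u₁, u₂)` with `|u₁ₖ| = |u₂ₖ|` for all `k`. -/
def setW (n : ℕ) : Set (EuclideanSpace ℂ (Fin n) × EuclideanSpace ℂ (Fin n)) :=
  {u | u ∈ stiefelTwo n ∧ ∀ k, ‖u.1 k‖ = ‖u.2 k‖}

/-- The subset `W_ij` of `W` where `u₁ᵢ` and `u₂ⱼ` are nonzero and real. -/
def setWij (n : ℕ) (i j : Fin n) :
    Set (EuclideanSpace ℂ (Fin n) × EuclideanSpace ℂ (Fin n)) :=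
  {u | u ∈ setW n ∧ u.1 i ≠ 0 ∧ u.2 j ≠ 0 ∧ (u.1 i).im = 0 ∧ (u.2 j).im = 0}

-- Put `c + i d = conj(u₁ₖ) u₂ₖ` and `t = |u₁ₖ|²`. On `W` each triple lies on the cone `c² + d² =
-- t²`, and the triples add up to `(0, 0, 1)`. A nonzero entry is determined by its cone point and
-- the phase of `u₁ₖ`, so there are at most `2n - 3` parameters for the cone points and `n` for the
-- phases. In `W_ij` with `i ≠ j` two phases are fixed up to sign; for `i = j` one phase is fixed
-- and `d i = 0`.
--
-- The count is made algebraic at each generic point: `ℝ[X]/P`, for `P` minimal over `I(S)`, has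
-- dimension at most the transcendence degree of its fraction field. That degree is bounded by the
-- number of elements from which all coordinates follow by field operations and square roots
-- (`semialgebraicDim_add_le`). The three sum conditions are used up by solving for two cone points
-- (`IsSqrtClosed.mem_of_cone_pair`). Positivity over `ℝ` keeps this solvable; it reaches the
-- generic point through `IsRealGenericPoint.transfer`.

universe u

/-! ### Generic points of real sets -/

open MvPolynomial in
/-- A point `ξ` of `K^σ` is generic in `S` if the polynomials vanishing at `ξ` form a minimal prime
over the vanishing ideal of `S`. -/
def IsRealGenericPoint {σ K : Type*} [Field K] [Algebra ℝ K] (S : Set (σ → ℝ)) (ξ : σ → K) : Prop :=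
  RingHom.ker (aeval (R := ℝ) ξ) ∈ (vanishingIdeal ℝ S).minimalPrimes

/-- A minimal prime over `I(S)` has the form `(I(S) : g)`. If `p * g` vanishes on `S`, then so does
`q * g`. Implications that hold only over the reals thus become available in `K`, which need not be
ordered. -/
theorem IsRealGenericPoint.transfer {σ K : Type*} [Finite σ] [Field K] [Algebra ℝ K]
    {S : Set (σ → ℝ)} {ξ : σ → K} (hξ : IsRealGenericPoint S ξ) {p q : MvPolynomial σ ℝ}
    (h : ∀ x ∈ S, MvPolynomial.eval x p = 0 → MvPolynomial.eval x q = 0)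
    (hp : MvPolynomial.aeval ξ p = 0) : MvPolynomial.aeval ξ q = 0 := by
  have hcolon : (MvPolynomial.vanishingIdeal ℝ S).colon {(1 : MvPolynomial σ ℝ)} =
      MvPolynomial.vanishingIdeal ℝ S := by
    ext r
    rw [Submodule.mem_colon_singleton, smul_eq_mul, mul_one]
  obtain ⟨g, hg⟩ := Submodule.exists_eq_colon_of_mem_minimalPrimes
    (N := MvPolynomial.vanishingIdeal ℝ S) (x := (1 : MvPolynomial σ ℝ))
    (I := RingHom.ker (MvPolynomial.aeval (R := ℝ) ξ)) (by rw [hcolon]; exact hξ)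
  have mem (r : MvPolynomial σ ℝ) : MvPolynomial.aeval ξ r = 0 ↔
      ∀ x ∈ S, MvPolynomial.eval x r * MvPolynomial.eval x g = 0 := by
    rw [← RingHom.mem_ker (f := MvPolynomial.aeval (R := ℝ) ξ), hg,
      Submodule.mem_colon_singleton, MvPolynomial.mem_vanishingIdeal_iff]
    simp [MvPolynomial.aeval_eq_eval]
  rw [mem] at hp ⊢
  intro x hx
  rcases mul_eq_zero.1 (hp x hx) with h0 | h0
  · rw [h x hx h0, zero_mul]
  · rw [h0, mul_zero]

theorem IsRealGenericPoint.aeval_eq_zero {σ K : Type*} [Finite σ] [Field K] [Algebra ℝ K]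
    {S : Set (σ → ℝ)} {ξ : σ → K} (hξ : IsRealGenericPoint S ξ) {q : MvPolynomial σ ℝ}
    (h : ∀ x ∈ S, MvPolynomial.eval x q = 0) : MvPolynomial.aeval ξ q = 0 :=
  hξ.transfer (p := 0) (fun x hx _ => h x hx) (map_zero _)

theorem IsRealGenericPoint.aeval_ne_zero {σ K : Type*} [Finite σ] [Field K] [Algebra ℝ K]
    {S : Set (σ → ℝ)} {ξ : σ → K} (hξ : IsRealGenericPoint S ξ) {q : MvPolynomial σ ℝ}
    (h : ∀ x ∈ S, MvPolynomial.eval x q ≠ 0) : MvPolynomial.aeval ξ q ≠ 0 := fun h0 => by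
  simpa using hξ.transfer (p := q) (q := 1) (fun x hx hq => absurd hq (h x hx)) h0

/-! ### Krull dimension and transcendence degree -/

theorem ringKrullDim_le_of_isIntegral {R A : Type*} [CommRing R] [CommRing A] [Algebra R A]
    [Algebra.IsIntegral R A] : ringKrullDim A ≤ ringKrullDim R :=
  Order.krullDim_le_of_strictMono (PrimeSpectrum.comap (algebraMap R A))
    fun _ _ h => Ideal.IsIntegral.comap_lt_comap h

theorem ringKrullDim_quotient_le_of_minimalPrimes {R : Type*} [CommRing R] (I : Ideal R)
    (d : WithBot ℕ∞) (h : ∀ P ∈ I.minimalPrimes, ringKrullDim (R ⧸ P) ≤ d) :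
    ringKrullDim (R ⧸ I) ≤ d := by
  rw [ringKrullDim_quotient]
  refine iSup_le fun l => ?_
  obtain ⟨P, hP, hle⟩ := Ideal.exists_minimalPrimes_le (I := I) (J := l.head.1.asIdeal) l.head.2
  refine le_trans ?_ (h P hP)
  rw [ringKrullDim_quotient]
  have hmem (i : Fin (l.length + 1)) : (l i).1 ∈ PrimeSpectrum.zeroLocus (P : Set R) :=
    hle.trans (LTSeries.head_le l i : l.head ≤ l i)
  exact Order.LTSeries.length_le_krullDim
    (⟨l.length, fun i => ⟨(l i).1, hmem i⟩, fun i => l.step i⟩ :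
      LTSeries (PrimeSpectrum.zeroLocus (P : Set R)))

-- Noether normalisation: `A` is integral over a polynomial ring whose variables stay algebraically
-- independent in `A`.
open Cardinal in
theorem ringKrullDim_le_of_trdeg_le {k A : Type*} [Field k] [CommRing A] [Nontrivial A]
    [Algebra k A] [Algebra.FiniteType k A] {d : ℕ} (h : Algebra.trdeg k A ≤ d) :
    ringKrullDim A ≤ d := by
  obtain ⟨s, g, hinj, hint⟩ := exists_integral_inj_algHom_of_fg k A
  have hs : s ≤ d := by
    have := lift_trdeg_le_of_injective g hinj
    rw [MvPolynomial.trdeg_of_isDomain] at this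
    simp only [mk_fin, lift_natCast] at this
    have h2 := this.trans (Cardinal.lift_le.2 h)
    simpa using h2
  algebraize [g.toRingHom]
  have hI : Algebra.IsIntegral (MvPolynomial (Fin s) k) A := ⟨hint⟩
  refine (ringKrullDim_le_of_isIntegral (R := MvPolynomial (Fin s) k)).trans ?_
  rw [MvPolynomial.ringKrullDim_of_isNoetherianRing, ringKrullDim_eq_zero_of_field]
  simpa using hs

/-- A subfield containing all square roots of its elements in the ambient field. -/
def IsSqrtClosed {K : Type*} [Field K] [Algebra ℝ K] (L : IntermediateField ℝ K) : Prop :=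
  ∀ x : K, x ^ 2 ∈ L → x ∈ L

-- The algebraic closure of `ℝ(B)` inside `K` is closed under square roots, so the hypothesis makes
-- `K` algebraic over `ℝ(B)`.
open Cardinal in
theorem trdeg_le_card_of_sqrtClosed {K : Type*} [Field K] [Algebra ℝ K] (B : Finset K)
    (h : ∀ L : IntermediateField ℝ K, IsSqrtClosed L → (∀ b ∈ B, b ∈ L) → ∀ x, x ∈ L) :
    Algebra.trdeg ℝ K ≤ B.card := by
  let F := IntermediateField.adjoin ℝ (B : Set K)
  have hF (x : K) (hx : x ∈ B) : x ∈ F := IntermediateField.subset_adjoin ℝ _ hx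
  let L := (algebraicClosure F K).restrictScalars ℝ
  have hmem (x : K) : x ∈ L ↔ IsAlgebraic F x := mem_algebraicClosure_iff
  have halg : Algebra.IsAlgebraic F K := by
    refine ⟨fun x => (hmem x).1 (h L ?_ ?_ x)⟩
    · intro y hy
      rw [hmem] at hy ⊢
      exact hy.of_pow two_pos
    · intro b hb
      exact (hmem b).2 (isAlgebraic_algebraMap (⟨b, hF b hb⟩ : F))
  have halg' : Algebra.IsAlgebraic (Algebra.adjoin ℝ (B : Set K)) K :=
    IntermediateField.isAlgebraic_adjoin_iff_top.1 halg
  simpa using Algebra.IsAlgebraic.trdeg_le_cardinalMk ℝ (B : Set K)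

-- Adding `r` on the left avoids truncated subtraction: dimension `⊥` satisfies the bound trivially,
-- and otherwise a generic point exists and forces `r ≤ N`.
open MvPolynomial in
theorem semialgebraicDim_add_le {σ : Type u} [Finite σ] (S : Set (σ → ℝ)) (r N : ℕ)
    (h : ∀ (K : Type u) [Field K] [Algebra ℝ K] (ξ : σ → K), IsRealGenericPoint S ξ →
      ∃ B : Finset K, B.card + r ≤ N ∧
        ∀ L : IntermediateField ℝ K, IsSqrtClosed L → (∀ b ∈ B, b ∈ L) → ∀ i, ξ i ∈ L) :
    semialgebraicDim S + r ≤ (N : WithBot ℕ∞) := by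
  have key (P : Ideal (MvPolynomial σ ℝ)) (hP : P ∈ (vanishingIdeal ℝ S).minimalPrimes) :
      r ≤ N ∧ ringKrullDim (MvPolynomial σ ℝ ⧸ P) ≤ ((N - r : ℕ) : WithBot ℕ∞) := by
    have := hP.isPrime
    let K := FractionRing (MvPolynomial σ ℝ ⧸ P)
    let φ : MvPolynomial σ ℝ ⧸ P →ₐ[ℝ] K := IsScalarTower.toAlgHom ℝ _ K
    have hφ : Function.Injective φ := IsFractionRing.injective _ K
    let ξ : σ → K := fun i => φ (Ideal.Quotient.mk P (X i))
    have hξ (p : MvPolynomial σ ℝ) : aeval ξ p = φ (Ideal.Quotient.mk P p) := by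
      have : aeval ξ = φ.comp (Ideal.Quotient.mkₐ ℝ P) := by
        ext i; simp [ξ]
      rw [this]; rfl
    have hgen : IsRealGenericPoint S ξ := by
      have : RingHom.ker (aeval (R := ℝ) ξ) = P := by
        ext p
        rw [RingHom.mem_ker, hξ, map_eq_zero_iff φ hφ, Ideal.Quotient.eq_zero_iff_mem]
      rw [IsRealGenericPoint, this]; exact hP
    obtain ⟨B, hB, hL⟩ := h K ξ hgen
    refine ⟨by omega, ringKrullDim_le_of_trdeg_le (k := ℝ) ?_⟩
    refine (trdeg_le_of_injective φ hφ).trans ?_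
    refine (trdeg_le_card_of_sqrtClosed B fun L hsq hBL x => ?_).trans
      (by exact_mod_cast (by omega : B.card ≤ N - r))
    have hp (a : MvPolynomial σ ℝ ⧸ P) : algebraMap _ K a ∈ L := by
      obtain ⟨p, rfl⟩ := Ideal.Quotient.mk_surjective a
      change φ _ ∈ L
      rw [← hξ]
      induction p using MvPolynomial.induction_on with
      | C a => simp
      | add p q hp hq => rw [map_add]; exact add_mem hp hq
      | mul_X p i hp => rw [map_mul, aeval_X]; exact mul_mem hp (hL L hsq hBL i)
    obtain ⟨a, b, -, rfl⟩ := IsFractionRing.div_surjective (A := MvPolynomial σ ℝ ⧸ P) x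
    exact div_mem (hp a) (hp b)
  by_cases htop : vanishingIdeal ℝ S = ⊤
  · have : Subsingleton (MvPolynomial σ ℝ ⧸ vanishingIdeal ℝ S) :=
      Ideal.Quotient.subsingleton_iff.2 htop
    rw [semialgebraicDim, ringKrullDim_eq_bot_of_subsingleton, WithBot.bot_add]
    exact bot_le
  · obtain ⟨P, hP⟩ := Ideal.nonempty_minimalPrimes htop
    have hr := (key P hP).1
    have : semialgebraicDim S ≤ ((N - r : ℕ) : WithBot ℕ∞) :=
      ringKrullDim_quotient_le_of_minimalPrimes _ _ fun P hP => (key P hP).2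
    calc semialgebraicDim S + r ≤ ((N - r : ℕ) : WithBot ℕ∞) + (r : WithBot ℕ∞) := by gcongr
      _ = (N : WithBot ℕ∞) := by rw [← Nat.cast_add, Nat.sub_add_cancel hr]

/-! ### Real equations and semialgebraicity -/

theorem IsSemialgebraic.inter {σ : Type*} {S T : Set (σ → ℝ)} (hS : IsSemialgebraic S)
    (hT : IsSemialgebraic T) : IsSemialgebraic (S ∩ T) := by
  have := (hS.compl.union hT.compl).compl
  rwa [Set.compl_union, compl_compl, compl_compl] at this

theorem isSemialgebraic_eq_zero {σ : Type*} (p : MvPolynomial σ ℝ) :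
    IsSemialgebraic {x | MvPolynomial.eval x p = 0} := by
  convert ((IsSemialgebraic.pos p).union (IsSemialgebraic.pos (-p))).compl using 1
  ext x
  simp [le_antisymm_iff]

theorem isSemialgebraic_univ {σ : Type*} : IsSemialgebraic (Set.univ : Set (σ → ℝ)) := by
  simpa using isSemialgebraic_eq_zero (0 : MvPolynomial σ ℝ)

theorem isSemialgebraic_forall {σ ι : Type*} [Finite ι] {S : ι → Set (σ → ℝ)}
    (h : ∀ i, IsSemialgebraic (S i)) : IsSemialgebraic {x | ∀ i, x ∈ S i} := by
  classical
  have := Fintype.ofFinite ι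
  suffices ∀ s : Finset ι, IsSemialgebraic {x | ∀ i ∈ s, x ∈ S i} by
    simpa using this Finset.univ
  intro s
  induction s using Finset.induction_on with
  | empty => simpa using isSemialgebraic_univ
  | insert a s _ ih =>
    convert (h a).inter ih using 1
    ext x
    simp

theorem mem_image_realCoords_setW {n : ℕ} {x : Fin 4 × Fin n → ℝ} :
    x ∈ realCoords n '' setW n ↔
      (∀ k, x (0, k) ^ 2 + x (1, k) ^ 2 = x (2, k) ^ 2 + x (3, k) ^ 2) ∧
      ∑ k, (x (0, k) ^ 2 + x (1, k) ^ 2) = 1 ∧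
      ∑ k, (x (0, k) * x (2, k) + x (1, k) * x (3, k)) = 0 ∧
      ∑ k, (x (0, k) * x (3, k) - x (1, k) * x (2, k)) = 0 := by
  have hnorm (z : ℂ) : ‖z‖ ^ 2 = z.re ^ 2 + z.im ^ 2 := by
    rw [← Complex.normSq_eq_norm_sq, Complex.normSq_apply]; ring
  have h1 (a b : ℂ) : ‖a‖ = ‖b‖ ↔ a.re ^ 2 + a.im ^ 2 = b.re ^ 2 + b.im ^ 2 := by
    rw [← hnorm, ← hnorm, sq_eq_sq₀ (norm_nonneg _) (norm_nonneg _)]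
  have h2 (v : EuclideanSpace ℂ (Fin n)) :
      ‖v‖ = 1 ↔ ∑ k, ((v k).re ^ 2 + (v k).im ^ 2) = 1 := by
    rw [← sq_eq_sq₀ (norm_nonneg v) zero_le_one, EuclideanSpace.norm_sq_eq]
    simp only [hnorm, one_pow]
  have h3 (v w : EuclideanSpace ℂ (Fin n)) : inner ℂ v w = 0 ↔
      ∑ k, ((v k).re * (w k).re + (v k).im * (w k).im) = 0 ∧
      ∑ k, ((v k).re * (w k).im - (v k).im * (w k).re) = 0 := by
    rw [PiLp.inner_apply, Complex.ext_iff, Complex.re_sum, Complex.im_sum]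
    simp only [RCLike.inner_apply, Complex.mul_re, Complex.mul_im, Complex.conj_re,
      Complex.conj_im, Complex.zero_re, Complex.zero_im]
    refine and_congr (Eq.congr_left (Finset.sum_congr rfl fun k _ => by ring))
      (Eq.congr_left (Finset.sum_congr rfl fun k _ => by ring))
  rw [Equiv.image_eq_preimage_symm, Set.mem_preimage, setW, Set.mem_ofPred_eq, stiefelTwo,
    Set.mem_ofPred_eq, orthonormal_vecCons_iff]
  simp only [h1, h2, h3, realCoords, Equiv.coe_fn_symm_mk, orthonormal_vecCons_iff,
    Fin.forall_fin_one, Matrix.cons_val_zero, IsEmpty.forall_iff]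
  have h0 : Orthonormal ℂ (![] : Fin 0 → EuclideanSpace ℂ (Fin n)) :=
    ⟨fun i => i.elim0, fun i => i.elim0⟩
  constructor
  · rintro ⟨⟨ha, ⟨hb, hc⟩, -⟩, hd⟩
    exact ⟨hd, ha, hb, hc⟩
  · rintro ⟨hd, ha, hb, hc⟩
    refine ⟨⟨ha, ⟨hb, hc⟩, ?_, trivial, h0⟩, hd⟩
    rw [← ha]
    exact Finset.sum_congr rfl fun k _ => (hd k).symm

theorem mem_image_realCoords_setWij {n : ℕ} {i j : Fin n} {x : Fin 4 × Fin n → ℝ} :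
    x ∈ realCoords n '' setWij n i j ↔ x ∈ realCoords n '' setW n ∧
      x (0, i) ≠ 0 ∧ x (2, j) ≠ 0 ∧ x (1, i) = 0 ∧ x (3, j) = 0 := by
  rw [Equiv.image_eq_preimage_symm, Equiv.image_eq_preimage_symm, Set.mem_preimage,
    Set.mem_preimage, setWij, Set.mem_ofPred_eq]
  refine and_congr_right fun _ => ?_
  simp only [realCoords, Equiv.coe_fn_symm_mk, Complex.ext_iff, ne_eq, Complex.zero_re,
    Complex.zero_im]
  tauto

open MvPolynomial in
theorem isSemialgebraic_setW (n : ℕ) : IsSemialgebraic (realCoords n '' setW n) := by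
  have h1 := isSemialgebraic_forall fun k : Fin n => isSemialgebraic_eq_zero
    (X (0, k) ^ 2 + X (1, k) ^ 2 - (X (2, k) ^ 2 + X (3, k) ^ 2) : MvPolynomial (Fin 4 × Fin n) ℝ)
  have h2 := isSemialgebraic_eq_zero
    (∑ k, (X (0, k) ^ 2 + X (1, k) ^ 2) - 1 : MvPolynomial (Fin 4 × Fin n) ℝ)
  have h3 := isSemialgebraic_eq_zero
    (∑ k, (X (0, k) * X (2, k) + X (1, k) * X (3, k)) : MvPolynomial (Fin 4 × Fin n) ℝ)
  have h4 := isSemialgebraic_eq_zero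
    (∑ k, (X (0, k) * X (3, k) - X (1, k) * X (2, k)) : MvPolynomial (Fin 4 × Fin n) ℝ)
  convert h1.inter (h2.inter (h3.inter h4)) using 1
  ext x
  rw [mem_image_realCoords_setW]
  simp [sub_eq_zero]

open MvPolynomial in
theorem isSemialgebraic_setWij (n : ℕ) (i j : Fin n) :
    IsSemialgebraic (realCoords n '' setWij n i j) := by
  have h (q : Fin 4 × Fin n) := isSemialgebraic_eq_zero (X q : MvPolynomial (Fin 4 × Fin n) ℝ)
  convert (isSemialgebraic_setW n).inter ((h (0, i)).compl.inter
    ((h (2, j)).compl.inter ((h (1, i)).inter (h (3, j))))) using 1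
  ext x
  rw [mem_image_realCoords_setWij]
  simp

/-! ### Points on a cone with prescribed sum -/

section ConeConfiguration

variable {K : Type*} [Field K]

/-- The points `(c k, d k, t k)` lie on the cone `c² + d² = t²`, add up to `(0, 0, 1)`, and no two
of them with `t k ≠ 0` add up to a point with `t² = c² = d²`. -/
structure IsConeConfiguration {n : ℕ} (c d t : Fin n → K) : Prop where
  cone : ∀ k, c k ^ 2 + d k ^ 2 = t k ^ 2
  sum_c : ∑ k, c k = 0
  sum_d : ∑ k, d k = 0
  sum_t : ∑ k, t k = 1
  eq_zero : ∀ k, t k = 0 → c k = 0 ∧ d k = 0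
  nondegenerate : ∀ e f, e ≠ f → t e ≠ 0 →
    (t e + t f) ^ 2 - (c e + c f) ^ 2 ≠ 0 ∨ (t e + t f) ^ 2 - (d e + d f) ^ 2 ≠ 0

namespace IsConeConfiguration

variable {n : ℕ} {c d t : Fin n → K}

/-- Otherwise the `i`-th point alone would be `(0, 0, 1)`, which is off the cone. -/
theorem exists_ne_zero (h : IsConeConfiguration c d t) (i : Fin n) : ∃ e, e ≠ i ∧ t e ≠ 0 := by
  by_contra! hne
  have ht : t i = 1 := by
    rw [← h.sum_t, Finset.sum_eq_single i (fun k _ hk => hne k hk) (by simp)]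
  have hc : c i = 0 := by
    rw [← h.sum_c, Finset.sum_eq_single i (fun k _ hk => (h.eq_zero k (hne k hk)).1) (by simp)]
  have hd : d i = 0 := by
    rw [← h.sum_d, Finset.sum_eq_single i (fun k _ hk => (h.eq_zero k (hne k hk)).2) (by simp)]
  simpa [ht, hc, hd] using h.cone i

theorem exists_pair (h : IsConeConfiguration c d t) : ∃ e f, e ≠ f ∧ t e ≠ 0 ∧ t f ≠ 0 := by
  have : Nonempty (Fin n) := by
    by_contra hn
    rw [not_nonempty_iff] at hn
    simpa using h.sum_t
  obtain ⟨e, -, he⟩ := h.exists_ne_zero (Classical.arbitrary _)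
  obtain ⟨f, hf, hf'⟩ := h.exists_ne_zero e
  exact ⟨e, f, hf.symm, he, hf'⟩

end IsConeConfiguration

end ConeConfiguration

/-! ### Solving for cone points by square roots -/

section SqrtClosed

variable {K : Type*} [Field K] [Algebra ℝ K] {L : IntermediateField ℝ K}

theorem IsSqrtClosed.mem_top_of_cone (hL : IsSqrtClosed L) {c d t : K}
    (h : c ^ 2 + d ^ 2 = t ^ 2) (hc : c ∈ L) (hd : d ∈ L) : t ∈ L :=
  hL t (by rw [← h]; exact add_mem (pow_mem hc 2) (pow_mem hd 2))

/-- Two points of the cone `c² + d² = t²` whose sum is given in `L`, the sum being outside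
`t² = c²`: if one coordinate `d₁` lies in `L`, then so does `c₁`. -/
theorem IsSqrtClosed.mem_of_cone_pair (hL : IsSqrtClosed L) {c₁ d₁ t₁ c₂ d₂ t₂ : K}
    (h₁ : c₁ ^ 2 + d₁ ^ 2 = t₁ ^ 2) (h₂ : c₂ ^ 2 + d₂ ^ 2 = t₂ ^ 2)
    (hc : c₁ + c₂ ∈ L) (hd : d₁ + d₂ ∈ L) (ht : t₁ + t₂ ∈ L)
    (hα : (t₁ + t₂) ^ 2 - (c₁ + c₂) ^ 2 ≠ 0) (hd₁ : d₁ ∈ L) : c₁ ∈ L := by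
  have : CharZero K := charZero_of_injective_algebraMap (algebraMap ℝ K).injective
  set C := c₁ + c₂ with hC
  set D := d₁ + d₂ with hD
  set T := t₁ + t₂ with hT
  have two : (2 : K) ∈ L := by simp
  -- Subtracting the two cone equations leaves the linear relation `T t₁ = m + C c₁`.
  set m := (T ^ 2 - C ^ 2 - D ^ 2) / 2 + D * d₁ with hm
  have hmL : m ∈ L := add_mem (div_mem (sub_mem (sub_mem (pow_mem ht 2) (pow_mem hc 2))
    (pow_mem hd 2)) two) (mul_mem hd hd₁)
  have hlin : T * t₁ = m + C * c₁ := by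
    rw [hm]
    have h2 : (2 : K) ≠ 0 := two_ne_zero
    field_simp
    rw [hC, hD, hT]
    linear_combination h₂ - h₁
  have hαL : T ^ 2 - C ^ 2 ∈ L := sub_mem (pow_mem ht 2) (pow_mem hc 2)
  -- Squaring the relation gives `T² (c₁² + d₁²) = (m + C c₁)²`, a quadratic in `c₁` with leading
  -- coefficient `T² - C²`; here its square is completed.
  have hsq : ((T ^ 2 - C ^ 2) * c₁ - m * C) ^ 2 =
      (m * C) ^ 2 - (T ^ 2 - C ^ 2) * (T ^ 2 * d₁ ^ 2 - m ^ 2) := by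
    linear_combination (T ^ 2 - C ^ 2) * (T ^ 2 * h₁ + (T * t₁ + m + C * c₁) * hlin)
  have hmC := mul_mem hmL hc
  have hlin2 : (T ^ 2 - C ^ 2) * c₁ - m * C ∈ L := by
    refine hL _ ?_
    rw [hsq]
    exact sub_mem (pow_mem hmC 2) (mul_mem hαL (sub_mem
      (mul_mem (pow_mem ht 2) (pow_mem hd₁ 2)) (pow_mem hmL 2)))
  have := div_mem (add_mem hlin2 hmC) hαL
  rwa [sub_add_cancel, mul_div_cancel_left₀ _ hα] at this

/-- The given data are `conj(x + iy) (a + ib)` and `|x + iy|²`. The latter yields `y` by a square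
root; multiplying the former by `x + iy` and dividing by the latter recovers `a + ib`. -/
theorem IsSqrtClosed.mem_of_planar (hL : IsSqrtClosed L) {x y a b : K}
    (hn : x ^ 2 + y ^ 2 ≠ 0) (ht : x ^ 2 + y ^ 2 ∈ L) (hc : x * a + y * b ∈ L)
    (hd : x * b - y * a ∈ L) (hx : x ∈ L) : y ∈ L ∧ a ∈ L ∧ b ∈ L := by
  have hy : y ∈ L := hL y (by
    have := sub_mem ht (pow_mem hx 2)
    rwa [add_sub_cancel_left] at this)
  have ha : a = (x * (x * a + y * b) - y * (x * b - y * a)) / (x ^ 2 + y ^ 2) := by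
    field_simp; ring
  have hb : b = (y * (x * a + y * b) + x * (x * b - y * a)) / (x ^ 2 + y ^ 2) := by
    field_simp; ring
  refine ⟨hy, ?_, ?_⟩
  · rw [ha]
    exact div_mem (sub_mem (mul_mem hx hc) (mul_mem hy hd)) ht
  · rw [hb]
    exact div_mem (add_mem (mul_mem hy hc) (mul_mem hx hd)) ht

theorem add_mem_of_sum_mem {n : ℕ} {c : Fin n → K} (hs : ∑ k, c k ∈ L) {e f : Fin n} (hef : e ≠ f)
    (h : ∀ k, k ≠ e → k ≠ f → c k ∈ L) : c e + c f ∈ L := by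
  rw [← Finset.add_sum_erase _ _ (Finset.mem_univ e),
    ← Finset.add_sum_erase _ _ (Finset.mem_erase.2 ⟨hef.symm, Finset.mem_univ f⟩),
    ← add_assoc] at hs
  have h' : ∑ k ∈ (Finset.univ.erase e).erase f, c k ∈ L := sum_mem fun k hk => by
    simp only [Finset.mem_erase, Finset.mem_univ, and_true] at hk
    exact h k hk.2 hk.1
  simpa using sub_mem hs h'

namespace IsConeConfiguration

variable {n : ℕ} {c d t : Fin n → K}

theorem forall_mem (h : IsConeConfiguration c d t) (hL : IsSqrtClosed L) {e f : Fin n}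
    (hef : e ≠ f) (hk : ∀ k, k ≠ e → k ≠ f → c k ∈ L ∧ d k ∈ L)
    (hcd : ((t e + t f) ^ 2 - (c e + c f) ^ 2 ≠ 0 ∧ d e ∈ L) ∨
      ((t e + t f) ^ 2 - (d e + d f) ^ 2 ≠ 0 ∧ c e ∈ L)) :
    ∀ k, c k ∈ L ∧ d k ∈ L ∧ t k ∈ L := by
  have hC : c e + c f ∈ L :=
    add_mem_of_sum_mem (by rw [h.sum_c]; exact zero_mem _) hef fun k h1 h2 => (hk k h1 h2).1
  have hD : d e + d f ∈ L :=
    add_mem_of_sum_mem (by rw [h.sum_d]; exact zero_mem _) hef fun k h1 h2 => (hk k h1 h2).2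
  have hT : t e + t f ∈ L :=
    add_mem_of_sum_mem (by rw [h.sum_t]; exact one_mem _) hef fun k h1 h2 =>
      hL.mem_top_of_cone (h.cone k) (hk k h1 h2).1 (hk k h1 h2).2
  have he : c e ∈ L ∧ d e ∈ L := by
    rcases hcd with ⟨h0, hd⟩ | ⟨h0, hc⟩
    · exact ⟨hL.mem_of_cone_pair (h.cone e) (h.cone f) hC hD hT h0 hd, hd⟩
    · refine ⟨hc, hL.mem_of_cone_pair (c₁ := d e) (d₁ := c e) (c₂ := d f) (d₂ := c f)
        ?_ ?_ hD hC hT h0 hc⟩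
      · rw [add_comm]; exact h.cone e
      · rw [add_comm]; exact h.cone f
  intro k
  have hcdk : c k ∈ L ∧ d k ∈ L := by
    by_cases h1 : k = e
    · rw [h1]; exact he
    by_cases h2 : k = f
    · rw [h2]
      exact ⟨by simpa using sub_mem hC he.1, by simpa using sub_mem hD he.2⟩
    exact hk k h1 h2
  exact ⟨hcdk.1, hcdk.2, hL.mem_top_of_cone (h.cone k) hcdk.1 hcdk.2⟩

/-- Over the points other than `e` and `f`, a single element generates the whole configuration. -/
theorem exists_generator (h : IsConeConfiguration c d t) {e f : Fin n} (hef : e ≠ f)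
    (he : t e ≠ 0) : ∃ g : K, ∀ L : IntermediateField ℝ K, IsSqrtClosed L → g ∈ L →
      (∀ k, t k ≠ 0 → k ≠ e → k ≠ f → c k ∈ L ∧ d k ∈ L) →
      ∀ k, c k ∈ L ∧ d k ∈ L ∧ t k ∈ L := by
  have hall (L : IntermediateField ℝ K)
      (hk : ∀ k, t k ≠ 0 → k ≠ e → k ≠ f → c k ∈ L ∧ d k ∈ L) (k : Fin n) (h1 : k ≠ e)
      (h2 : k ≠ f) : c k ∈ L ∧ d k ∈ L := by
    by_cases h0 : t k = 0
    · rw [(h.eq_zero k h0).1, (h.eq_zero k h0).2]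
      exact ⟨zero_mem _, zero_mem _⟩
    · exact hk k h0 h1 h2
  rcases h.nondegenerate e f hef he with h0 | h0
  · exact ⟨d e, fun L hL hg hk => h.forall_mem hL hef (hall L hk) (.inl ⟨h0, hg⟩)⟩
  · exact ⟨c e, fun L hL hg hk => h.forall_mem hL hef (hall L hk) (.inr ⟨h0, hg⟩)⟩

end IsConeConfiguration

end SqrtClosed

/-! ### Cone coordinates of a pair of vectors -/

section Coordinates

variable {R : Type*} [CommRing R] {n : ℕ}

/-- The squared norm `|u₁ₖ|²` in terms of the real coordinates. -/
def coordT (ξ : Fin 4 × Fin n → R) (k : Fin n) : R := ξ (0, k) ^ 2 + ξ (1, k) ^ 2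

/-- The real part of the product of the conjugate of `u₁ₖ` with `u₂ₖ`. -/
def coordC (ξ : Fin 4 × Fin n → R) (k : Fin n) : R := ξ (0, k) * ξ (2, k) + ξ (1, k) * ξ (3, k)

/-- The imaginary part of the product of the conjugate of `u₁ₖ` with `u₂ₖ`. -/
def coordD (ξ : Fin 4 × Fin n → R) (k : Fin n) : R := ξ (0, k) * ξ (3, k) - ξ (1, k) * ξ (2, k)

theorem eval_coord (x : Fin 4 × Fin n → ℝ) (k : Fin n) :
    MvPolynomial.eval x (coordT MvPolynomial.X k) = coordT x k ∧
    MvPolynomial.eval x (coordC MvPolynomial.X k) = coordC x k ∧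
    MvPolynomial.eval x (coordD MvPolynomial.X k) = coordD x k := by
  simp [coordT, coordC, coordD]

theorem aeval_coord [Algebra ℝ R] (ξ : Fin 4 × Fin n → R) (k : Fin n) :
    MvPolynomial.aeval (R := ℝ) ξ (coordT MvPolynomial.X k) = coordT ξ k ∧
    MvPolynomial.aeval (R := ℝ) ξ (coordC MvPolynomial.X k) = coordC ξ k ∧
    MvPolynomial.aeval (R := ℝ) ξ (coordD MvPolynomial.X k) = coordD ξ k := by
  simp [coordT, coordC, coordD]

theorem coord_cone {x : Fin 4 × Fin n → R} {k : Fin n}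
    (h : x (0, k) ^ 2 + x (1, k) ^ 2 = x (2, k) ^ 2 + x (3, k) ^ 2) :
    coordC x k ^ 2 + coordD x k ^ 2 = coordT x k ^ 2 := by
  simp only [coordC, coordD, coordT]
  linear_combination -(x (0, k) ^ 2 + x (1, k) ^ 2) * h

theorem coordT_nonneg (x : Fin 4 × Fin n → ℝ) (k : Fin n) : 0 ≤ coordT x k := by
  unfold coordT; positivity

theorem coord_eq_zero_of_coordT_eq_zero {x : Fin 4 × Fin n → ℝ} (hx : x ∈ realCoords n '' setW n)
    {k : Fin n} (h : coordT x k = 0) (q : Fin 4) : x (q, k) = 0 := by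
  have h' : x (2, k) ^ 2 + x (3, k) ^ 2 = 0 := by
    rw [← (mem_image_realCoords_setW.1 hx).1 k]; exact h
  unfold coordT at h
  fin_cases q <;> simp <;> nlinarith [sq_nonneg (x (0, k)), sq_nonneg (x (1, k)),
    sq_nonneg (x (2, k)), sq_nonneg (x (3, k))]

end Coordinates

/-- The two equations add up to `C² + D² = 2T²` for the summed point, while Cauchy–Schwarz gives `C²
+ D² ≤ T²`. Hence `T = 0`, and both heights are nonnegative. -/
theorem eq_zero_of_cone_add_degenerate {c d t c' d' t' : ℝ} (ht : 0 ≤ t) (ht' : 0 ≤ t')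
    (h : c ^ 2 + d ^ 2 = t ^ 2) (h' : c' ^ 2 + d' ^ 2 = t' ^ 2)
    (hc : (t + t') ^ 2 - (c + c') ^ 2 = 0) (hd : (t + t') ^ 2 - (d + d') ^ 2 = 0) : t = 0 := by
  have hcs : c * c' + d * d' ≤ t * t' := by
    refine le_of_sq_le_sq ?_ (mul_nonneg ht ht')
    have : (t * t') ^ 2 = (c * c' + d * d') ^ 2 + (c * d' - d * c') ^ 2 := by
      rw [mul_pow, ← h, ← h']; ring
    nlinarith [sq_nonneg (c * d' - d * c')]
  nlinarith [mul_nonneg ht ht', sq_nonneg t, sq_nonneg t']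

/-! ### The cone configuration of a generic point -/

section GenericPoint

variable {K : Type*} [Field K] [Algebra ℝ K] {n : ℕ} {S : Set (Fin 4 × Fin n → ℝ)}
  {ξ : Fin 4 × Fin n → K}

theorem IsRealGenericPoint.coord_eq_zero (hξ : IsRealGenericPoint S ξ)
    (hS : S ⊆ realCoords n '' setW n) {k : Fin n} (h : coordT ξ k = 0) (q : Fin 4) :
    ξ (q, k) = 0 := by
  rw [← MvPolynomial.aeval_X (R := ℝ) ξ]
  refine hξ.transfer (p := coordT MvPolynomial.X k) (fun x hx h0 => ?_)
    ((aeval_coord ξ k).1.trans h)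
  rw [(eval_coord x k).1] at h0
  simpa using coord_eq_zero_of_coordT_eq_zero (hS hx) h0 q

theorem IsRealGenericPoint.isConeConfiguration (hξ : IsRealGenericPoint S ξ)
    (hS : S ⊆ realCoords n '' setW n) :
    IsConeConfiguration (coordC ξ) (coordD ξ) (coordT ξ) where
  cone k := by
    refine coord_cone ?_
    have := hξ.aeval_eq_zero (q := MvPolynomial.X (0, k) ^ 2 + MvPolynomial.X (1, k) ^ 2 -
      (MvPolynomial.X (2, k) ^ 2 + MvPolynomial.X (3, k) ^ 2)) fun x hx => by
        simpa [sub_eq_zero] using (mem_image_realCoords_setW.1 (hS hx)).1 k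
    simpa [sub_eq_zero] using this
  sum_c := by
    have := hξ.aeval_eq_zero (q := ∑ k, coordC MvPolynomial.X k) fun x hx => by
      simp only [map_sum, eval_coord]
      exact (mem_image_realCoords_setW.1 (hS hx)).2.2.1
    simpa [aeval_coord] using this
  sum_d := by
    have := hξ.aeval_eq_zero (q := ∑ k, coordD MvPolynomial.X k) fun x hx => by
      simp only [map_sum, eval_coord]
      exact (mem_image_realCoords_setW.1 (hS hx)).2.2.2
    simpa [aeval_coord] using this
  sum_t := by
    have := hξ.aeval_eq_zero (q := ∑ k, coordT MvPolynomial.X k - 1) fun x hx => by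
      simp only [map_sub, map_sum, map_one, eval_coord, sub_eq_zero]
      exact (mem_image_realCoords_setW.1 (hS hx)).2.1
    simpa [aeval_coord, sub_eq_zero] using this
  eq_zero k h := by
    simp [coordC, coordD, hξ.coord_eq_zero hS h]
  nondegenerate e f hef he := by
    by_contra! h0
    refine he ?_
    rw [← (aeval_coord ξ e).1]
    let α (g : (Fin 4 × Fin n → MvPolynomial (Fin 4 × Fin n) ℝ) → Fin n →
        MvPolynomial (Fin 4 × Fin n) ℝ) : MvPolynomial (Fin 4 × Fin n) ℝ :=
      (coordT MvPolynomial.X e + coordT MvPolynomial.X f) ^ 2 -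
        (g MvPolynomial.X e + g MvPolynomial.X f) ^ 2
    -- Over `ℝ` the sum of squares encodes both degeneracy equations in a single polynomial.
    refine hξ.transfer (p := α coordC ^ 2 + α coordD ^ 2) (fun x hx hp => ?_) ?_
    · simp only [α, map_add, map_sub, map_pow, eval_coord] at hp ⊢
      have hcone (k : Fin n) := coord_cone ((mem_image_realCoords_setW.1 (hS hx)).1 k)
      refine eq_zero_of_cone_add_degenerate (coordT_nonneg x e) (coordT_nonneg x f)
        (hcone e) (hcone f) ?_ ?_
      · exact pow_eq_zero_iff two_ne_zero |>.1
          ((add_eq_zero_iff_of_nonneg (sq_nonneg _) (sq_nonneg _)).1 hp).1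
      · exact pow_eq_zero_iff two_ne_zero |>.1
          ((add_eq_zero_iff_of_nonneg (sq_nonneg _) (sq_nonneg _)).1 hp).2
    · simp only [α, map_add, map_sub, map_pow, aeval_coord]
      rw [h0.1, h0.2]; simp

theorem IsRealGenericPoint.forall_coord_mem (hξ : IsRealGenericPoint S ξ)
    (hS : S ⊆ realCoords n '' setW n) {L : IntermediateField ℝ K} (hL : IsSqrtClosed L)
    (hcdt : ∀ k, coordC ξ k ∈ L ∧ coordD ξ k ∈ L ∧ coordT ξ k ∈ L)
    (hx : ∀ k, coordT ξ k ≠ 0 → ξ (0, k) ∈ L) (q : Fin 4 × Fin n) : ξ q ∈ L := by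
  obtain ⟨q, k⟩ := q
  by_cases h0 : coordT ξ k = 0
  · rw [hξ.coord_eq_zero hS h0]; exact zero_mem _
  · obtain ⟨hc, hd, ht⟩ := hcdt k
    obtain ⟨hy, ha, hb⟩ := hL.mem_of_planar h0 ht hc hd (hx k h0)
    fin_cases q
    exacts [hx k h0, hy, ha, hb]

end GenericPoint

/-! ### Counting generators -/

section Generators

variable {K : Type*} [Field K] [Algebra ℝ K] {n : ℕ} {ξ : Fin 4 × Fin n → K}

-- With `a` nonzero entries: `a` values `ξ (0, k)`, cone points away from a pair `e`, `f`, and one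
-- `g` make `a + 2(a - 2) + 1 = 3a - 3`.
open Classical in
theorem exists_generators_setW (hξ : IsRealGenericPoint (realCoords n '' setW n) ξ) :
    ∃ B : Finset K, B.card + 3 ≤ 3 * n ∧
      ∀ L : IntermediateField ℝ K, IsSqrtClosed L → (∀ b ∈ B, b ∈ L) → ∀ i, ξ i ∈ L := by
  have hcfg := hξ.isConeConfiguration subset_rfl
  obtain ⟨e, f, hef, he, hf⟩ := hcfg.exists_pair
  obtain ⟨g, hg⟩ := hcfg.exists_generator hef he
  set A : Finset (Fin n) := {k | coordT ξ k ≠ 0} with hA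
  have hAn : A.card ≤ n := by simpa using A.card_le_univ
  have hefA : {e, f} ⊆ A := by
    simp [hA, Finset.insert_subset_iff, he, hf]
  have h2 : (A \ {e, f}).card + 2 = A.card := by
    rw [← Finset.card_pair hef, Finset.card_sdiff_add_card_eq_card hefA]
  refine ⟨A.image (fun k => ξ (0, k)) ∪ ((A \ {e, f}).image (coordC ξ) ∪
    ((A \ {e, f}).image (coordD ξ) ∪ {g})), ?_, fun L hL hB => ?_⟩
  · have i1 := Finset.card_image_le (s := A) (f := fun k => ξ (0, k))
    have i2 := Finset.card_image_le (s := A \ {e, f}) (f := coordC ξ)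
    have i3 := Finset.card_image_le (s := A \ {e, f}) (f := coordD ξ)
    have u1 := Finset.card_union_le (A.image (fun k => ξ (0, k)))
      ((A \ {e, f}).image (coordC ξ) ∪ ((A \ {e, f}).image (coordD ξ) ∪ {g}))
    have u2 := Finset.card_union_le ((A \ {e, f}).image (coordC ξ))
      ((A \ {e, f}).image (coordD ξ) ∪ {g})
    have u3 := Finset.card_union_le ((A \ {e, f}).image (coordD ξ)) {g}
    rw [Finset.card_singleton] at u3
    omega
  · simp only [Finset.forall_mem_union, Finset.forall_mem_image, Finset.mem_singleton,
      forall_eq] at hB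
    obtain ⟨hx, hc, hd, hgL⟩ := hB
    refine hξ.forall_coord_mem subset_rfl hL (hg L hL hgL fun k h0 h1 h2 => ?_)
      fun k h0 => hx (by simpa [hA] using h0)
    have : k ∈ A \ {e, f} := by simp [hA, h0, h1, h2]
    exact ⟨hc this, hd this⟩

variable {i j : Fin n}

theorem image_setWij_subset (n : ℕ) (i j : Fin n) :
    realCoords n '' setWij n i j ⊆ realCoords n '' setW n :=
  Set.image_mono fun _ h => h.1

theorem IsRealGenericPoint.setWij_coord
    (hξ : IsRealGenericPoint (realCoords n '' setWij n i j) ξ) :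
    ξ (1, i) = 0 ∧ ξ (3, j) = 0 ∧ ξ (2, j) ≠ 0 ∧ coordT ξ i ≠ 0 ∧ coordT ξ j ≠ 0 ∧
      coordT ξ j = ξ (2, j) ^ 2 := by
  have h1 := hξ.aeval_eq_zero (q := MvPolynomial.X (1, i)) fun x hx => by
    simpa using (mem_image_realCoords_setWij.1 hx).2.2.2.1
  have h3 := hξ.aeval_eq_zero (q := MvPolynomial.X (3, j)) fun x hx => by
    simpa using (mem_image_realCoords_setWij.1 hx).2.2.2.2
  have h2 := hξ.aeval_ne_zero (q := MvPolynomial.X (2, j)) fun x hx => by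
    simpa using (mem_image_realCoords_setWij.1 hx).2.2.1
  have h0 := hξ.aeval_ne_zero (q := MvPolynomial.X (0, i)) fun x hx => by
    simpa using (mem_image_realCoords_setWij.1 hx).2.1
  have hn := hξ.aeval_eq_zero (q := coordT MvPolynomial.X j - MvPolynomial.X (2, j) ^ 2)
    fun x hx => by
      obtain ⟨hW, -, -, -, h⟩ := mem_image_realCoords_setWij.1 hx
      have := (mem_image_realCoords_setW.1 hW).1 j
      rw [h] at this
      simpa [coordT, sub_eq_zero] using this
  simp only [MvPolynomial.aeval_X, map_sub, map_pow, aeval_coord, sub_eq_zero] at h0 h1 h2 h3 hn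
  refine ⟨h1, h3, h2, ?_, ?_, hn⟩
  · simpa [coordT, h1] using h0
  · rw [hn]; exact pow_ne_zero 2 h2

/-- Once the cone coordinates are known, the normalisation of `u₁ᵢ` and `u₂ⱼ` determines `u₁ᵢ` and
`u₁ⱼ` up to sign. -/
theorem IsRealGenericPoint.forall_setWij_coord_mem
    (hξ : IsRealGenericPoint (realCoords n '' setWij n i j) ξ) {L : IntermediateField ℝ K}
    (hL : IsSqrtClosed L)
    (hcdt : ∀ k, coordC ξ k ∈ L ∧ coordD ξ k ∈ L ∧ coordT ξ k ∈ L)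
    (hx : ∀ k, coordT ξ k ≠ 0 → k ≠ i → k ≠ j → ξ (0, k) ∈ L) (q : Fin 4 × Fin n) : ξ q ∈ L := by
  obtain ⟨h1, h3, h2, -, -, hn⟩ := hξ.setWij_coord
  refine hξ.forall_coord_mem (image_setWij_subset n i j) hL hcdt (fun k h0 => ?_) q
  by_cases hki : k = i
  · rw [hki]
    refine hL _ ?_
    simpa [coordT, h1] using (hcdt i).2.2
  by_cases hkj : k = j
  · rw [hkj]
    have ha : ξ (2, j) ∈ L := hL _ (hn ▸ (hcdt j).2.2)
    have := div_mem (hcdt j).1 ha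
    rwa [coordC, h3, mul_zero, add_zero, mul_div_cancel_right₀ _ h2] at this
  exact hx k h0 hki hkj

-- Taking `{i, j}` as the pair solved for, `ξ (0, k)` is also needed only outside it: `3(a - 2) + 1
-- = 3a - 5`.
open Classical in
theorem exists_generators_setWij_of_ne (hij : i ≠ j)
    (hξ : IsRealGenericPoint (realCoords n '' setWij n i j) ξ) :
    ∃ B : Finset K, B.card + 5 ≤ 3 * n ∧
      ∀ L : IntermediateField ℝ K, IsSqrtClosed L → (∀ b ∈ B, b ∈ L) → ∀ i, ξ i ∈ L := by
  have hcfg := hξ.isConeConfiguration (image_setWij_subset n i j)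
  obtain ⟨-, -, -, hi, hj, -⟩ := hξ.setWij_coord
  obtain ⟨g, hg⟩ := hcfg.exists_generator hij hi
  set A : Finset (Fin n) := {k | coordT ξ k ≠ 0} with hA
  have hAn : A.card ≤ n := by simpa using A.card_le_univ
  have hijA : {i, j} ⊆ A := by
    simp [hA, Finset.insert_subset_iff, hi, hj]
  set A' := A \ {i, j} with hA'
  have h2 : A'.card + 2 = A.card := by
    rw [← Finset.card_pair hij, Finset.card_sdiff_add_card_eq_card hijA]
  refine ⟨A'.image (fun k => ξ (0, k)) ∪ (A'.image (coordC ξ) ∪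
    (A'.image (coordD ξ) ∪ {g})), ?_, fun L hL hB => ?_⟩
  · have i1 := Finset.card_image_le (s := A') (f := fun k => ξ (0, k))
    have i2 := Finset.card_image_le (s := A') (f := coordC ξ)
    have i3 := Finset.card_image_le (s := A') (f := coordD ξ)
    have u1 := Finset.card_union_le (A'.image (fun k => ξ (0, k)))
      (A'.image (coordC ξ) ∪ (A'.image (coordD ξ) ∪ {g}))
    have u2 := Finset.card_union_le (A'.image (coordC ξ)) (A'.image (coordD ξ) ∪ {g})
    have u3 := Finset.card_union_le (A'.image (coordD ξ)) {g}
    rw [Finset.card_singleton] at u3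
    omega
  · simp only [Finset.forall_mem_union, Finset.forall_mem_image, Finset.mem_singleton,
      forall_eq] at hB
    obtain ⟨hx, hc, hd, hgL⟩ := hB
    have hmem (k : Fin n) (h0 : coordT ξ k ≠ 0) (h1 : k ≠ i) (h2 : k ≠ j) : k ∈ A' := by
      simp [hA', hA, h0, h1, h2]
    exact hξ.forall_setWij_coord_mem hL
      (hg L hL hgL fun k h0 h1 h2 => ⟨hc (hmem k h0 h1 h2), hd (hmem k h0 h1 h2)⟩)
      fun k h0 h1 h2 => hx (hmem k h0 h1 h2)

open Classical in
/-- If only one entry besides the `i`-th is nonzero, the cone configuration is algebraic, because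
its `i`-th point lies in the plane `d = 0`. -/
theorem exists_generators_setWii_of_forall_eq_zero {f : Fin n} (hif : i ≠ f)
    (hξ : IsRealGenericPoint (realCoords n '' setWij n i i) ξ)
    (hf : ∀ k, k ≠ i → k ≠ f → coordT ξ k = 0) :
    ∃ B : Finset K, B.card + 5 ≤ 3 * n ∧
      ∀ L : IntermediateField ℝ K, IsSqrtClosed L → (∀ b ∈ B, b ∈ L) → ∀ i, ξ i ∈ L := by
  have hcfg := hξ.isConeConfiguration (image_setWij_subset n i i)
  obtain ⟨h1, h3, -, -, -, -⟩ := hξ.setWij_coord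
  have hsum (c : Fin n → K) (hc : ∀ k, coordT ξ k = 0 → c k = 0) : c i + c f = ∑ k, c k := by
    rw [← Finset.sum_pair hif]
    refine Finset.sum_subset (Finset.subset_univ _) fun k _ hk => hc k (hf k ?_ ?_) <;>
    · rintro rfl; simp at hk
  have hcs := (hsum _ fun k h => (hcfg.eq_zero k h).1).trans hcfg.sum_c
  have hts := (hsum _ fun k h => h).trans hcfg.sum_t
  have hn : 2 ≤ n := by
    have := Finset.card_le_univ {i, f}
    rwa [Finset.card_pair hif, Fintype.card_fin] at this
  refine ⟨{ξ (0, f)}, by rw [Finset.card_singleton]; omega, fun L hL hB => ?_⟩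
  -- The pair `i`, `f` has sum `(0, 0, 1)`, so `T² - C² = 1`; and `d i = 0` because `ξ (1, i)` and
  -- `ξ (3, i)` vanish.
  refine hξ.forall_setWij_coord_mem hL (hcfg.forall_mem hL hif (fun k hki hkf => ?_)
    (.inl ⟨by simp [hcs, hts], by simp [coordD, h1, h3]⟩)) fun k h0 hki _ => ?_
  · rw [(hcfg.eq_zero k (hf k hki hkf)).1, (hcfg.eq_zero k (hf k hki hkf)).2]
    exact ⟨zero_mem _, zero_mem _⟩
  · have hkf : k = f := by
      by_contra hkf
      exact h0 (hf k hki hkf)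
    exact hkf ▸ hB _ (Finset.mem_singleton_self _)

-- The pair solved for must avoid `i`, so that `d i = 0` saves a parameter. The count is `(a - 1) +
-- (a - 2) + (a - 3) + 1 = 3a - 5`, for `ξ (0, k)`, `c`, `d` and `g`.
open Classical in
theorem exists_generators_setWii (hξ : IsRealGenericPoint (realCoords n '' setWij n i i) ξ) :
    ∃ B : Finset K, B.card + 5 ≤ 3 * n ∧
      ∀ L : IntermediateField ℝ K, IsSqrtClosed L → (∀ b ∈ B, b ∈ L) → ∀ i, ξ i ∈ L := by
  have hcfg := hξ.isConeConfiguration (image_setWij_subset n i i)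
  obtain ⟨h1, h3, -, hi, -, -⟩ := hξ.setWij_coord
  obtain ⟨f, hfi, hf⟩ := hcfg.exists_ne_zero i
  by_cases hall : ∀ k, k ≠ i → k ≠ f → coordT ξ k = 0
  · exact exists_generators_setWii_of_forall_eq_zero hfi.symm hξ hall
  push Not at hall
  obtain ⟨e, hei, hef, he⟩ := hall
  obtain ⟨g, hg⟩ := hcfg.exists_generator hef he
  set A : Finset (Fin n) := {k | coordT ξ k ≠ 0} with hA
  have hAn : A.card ≤ n := by simpa using A.card_le_univ
  have hiA : {i} ⊆ A := by simp [hA, hi]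
  have hefA : {e, f} ⊆ A := by simp [hA, Finset.insert_subset_iff, he, hf]
  have hief : i ∉ ({e, f} : Finset (Fin n)) := by simp [hei.symm, hfi.symm]
  have hiefA : insert i {e, f} ⊆ A := by
    rw [Finset.insert_subset_iff]
    exact ⟨Finset.singleton_subset_iff.1 hiA, hefA⟩
  set A₁ := A \ {i} with hA₁
  set A₂ := A \ {e, f} with hA₂
  set A₃ := A \ insert i {e, f} with hA₃
  have c1 : A₁.card + 1 = A.card := by
    rw [← Finset.card_singleton i, Finset.card_sdiff_add_card_eq_card hiA]
  have c2 : A₂.card + 2 = A.card := by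
    rw [← Finset.card_pair hef, Finset.card_sdiff_add_card_eq_card hefA]
  have c3 : A₃.card + 3 = A.card := by
    have := Finset.card_sdiff_add_card_eq_card hiefA
    rwa [Finset.card_insert_of_notMem hief, Finset.card_pair hef] at this
  refine ⟨A₁.image (fun k => ξ (0, k)) ∪ (A₂.image (coordC ξ) ∪
    (A₃.image (coordD ξ) ∪ {g})), ?_, fun L hL hB => ?_⟩
  · have i1 := Finset.card_image_le (s := A₁) (f := fun k => ξ (0, k))
    have i2 := Finset.card_image_le (s := A₂) (f := coordC ξ)
    have i3 := Finset.card_image_le (s := A₃) (f := coordD ξ)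
    have u1 := Finset.card_union_le (A₁.image (fun k => ξ (0, k)))
      (A₂.image (coordC ξ) ∪ (A₃.image (coordD ξ) ∪ {g}))
    have u2 := Finset.card_union_le (A₂.image (coordC ξ)) (A₃.image (coordD ξ) ∪ {g})
    have u3 := Finset.card_union_le (A₃.image (coordD ξ)) {g}
    rw [Finset.card_singleton] at u3
    omega
  · simp only [Finset.forall_mem_union, Finset.forall_mem_image, Finset.mem_singleton,
      forall_eq] at hB
    obtain ⟨hx, hc, hd, hgL⟩ := hB
    refine hξ.forall_setWij_coord_mem hL (hg L hL hgL fun k h0 h1' h2' => ⟨?_, ?_⟩)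
      fun k h0 hki _ => hx (by simp [hA₁, hA, h0, hki])
    · exact hc (by simp [hA₂, hA, h0, h1', h2'])
    · by_cases hki : k = i
      · simp [hki, coordD, h1, h3]
      · exact hd (by simp [hA₃, hA, h0, h1', h2', hki])

end Generators

theorem lemma4 (n : ℕ) :
    (IsSemialgebraic (realCoords n '' setW n) ∧
      semialgebraicDim (realCoords n '' setW n) + 3 ≤ ((3 * n : ℕ) : WithBot ℕ∞)) ∧
    ∀ i j : Fin n,
      IsSemialgebraic (realCoords n '' setWij n i j) ∧
      semialgebraicDim (realCoords n '' setWij n i j) + 5 ≤ ((3 * n : ℕ) : WithBot ℕ∞) := by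
  refine ⟨⟨isSemialgebraic_setW n, ?_⟩, fun i j => ⟨isSemialgebraic_setWij n i j, ?_⟩⟩
  · exact semialgebraicDim_add_le _ 3 _ fun K _ _ ξ hξ => exists_generators_setW hξ
  · refine semialgebraicDim_add_le _ 5 _ fun K _ _ ξ hξ => ?_
    by_cases hij : i = j
    · subst hij
      exact exists_generators_setWii hξ
    · exact exists_generators_setWij_of_ne hij hξ
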